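/- For a point $\omega\in\mathbb{R}^{\mathbb N}$ and $K\subset\mathbb N$ let $\mathrm{Cyl}(K,\omega)=\{\omega'\in\mathbb{R}^{\mathbb N}:\ \omega'_i=\omega_i \text{ for all } i\in K\}$, and for $A\subset\mathbb{R}^{\mathbb N}$ let $[A]_K=\{\omega:\ \mathrm{Cyl}(K,\omega)\subset A\}$. For sets $A,B$ and $A_1,\dots,A_r$ in $\mathbb{R}^{\mathbb N}$ define the finite-witness BKR combinations $$A\,\square\, B=\bigcup_{\substack{J,K\subset\mathbb N\\ \text{finite, disjoint}}}[A]_J\cap[B]_K,\qquad \square_{i=1}^r A_i=\bigcup_{\substack{J_1,\dots,J_r\subset\mathbb N\\ \text{finite, pairwise disjoint}}}\ \bigcap_{i=1}^r[A_i]_{J_i}.$$ Theorem. Let $\mu_0,\mu_1,\mu_2,\dots$ be arbitrary Borel probability measures on $\mathbb{R}$, and let $P$ be the completion of the product probability measure $\bigotimes_{i\in\mathbb N}\mu_i$ on the Borel sets of $\mathbb{R}^{\mathbb N}$. (1) For all Borel sets $A,B\subset\mathbb{R}^{\mathbb N}$, the set $A\,\square\, B$ is $P$-measurable (it belongs to the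 completed $\sigma$-algebra), and $P(A\,\square\, B)\le P(A)\,P(B)$. (2) For every integer $r\ge 0$ and all Borel sets $A_1,\dots,A_r\subset\mathbb{R}^{\mathbb N}$, the set $\square_{i=1}^r A_i$ is $P$-measurable, and $P\big(\square_{i=1}^r A_i\big)\le\prod_{i=1}^r P(A_i)$. (For $r=0$ the empty intersection is $\mathbb{R}^{\mathbb N}$ and the empty product is $1$.) -/

import Mathlib

open MeasureTheory

/-- The thin cylinder `Cyl(K, ω)`: all points of `S^I` that agree with `ω` on `K`. -/
def thinCyl {I S : Type*} (K : Set I) (ω : I → S) : Set (I → S) :=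
  {ω' | ∀ i ∈ K, ω' i = ω i}

/-- `[A]_K`, the largest cylinder contained in `A` that is free in the coordinates outside `K`. -/
def maxCyl {I S : Type*} (A : Set (I → S)) (K : Set I) : Set (I → S) :=
  {ω | thinCyl K ω ⊆ A}

/-- The finite-witness BKR combination `A □ B`: the union, over all finite disjoint `J`, `K`, of
`[A]_J ∩ [B]_K`. -/
def bkr {I S : Type*} (A B : Set (I → S)) : Set (I → S) :=
  ⋃ (J : Finset I) (K : Finset I) (_ : Disjoint J K), maxCyl A (J : Set I) ∩ maxCyl B (K : Set I)

/-- The simultaneous `r`-fold finite-witness BKR combination: the union, over all finite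
pairwise disjoint `J 0, …, J (r - 1)`, of the intersection of the `[A i]_(J i)`. -/
def bkrMany {I S : Type*} {r : ℕ} (A : Fin r → Set (I → S)) : Set (I → S) :=
  ⋃ (J : Fin r → Finset I) (_ : ∀ i j, i ≠ j → Disjoint (J i) (J j)),
    ⋂ i, maxCyl (A i) (J i : Set I)

/-- The complete product probability measure on `ℝ^ℕ` with marginals `μ i`: the completion of the
product measure on the Borel σ-algebra. It lives on the completed σ-algebra, whose measurable sets
are the null-measurable sets of the product measure. -/
noncomputable def completeProd (μ : ℕ → Measure ℝ) [∀ i, IsProbabilityMeasure (μ i)] :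
    Measure (NullMeasurableSpace (ℕ → ℝ) (Measure.infinitePi μ)) :=
  (Measure.infinitePi μ).completion

/-! The core is Reimer's inequality on the uniform cube. `ncard_bkr_le_ncard_xor` proves it for each
shift `d` by linear algebra. Product vectors indexed by the cube form two integer matrices, one
invertible mod 2 and the other mod 3. The product of one with the transpose of the other is
nonsingular and has a large zero block, which forces the count. Averaging over `d` gives the usual
form.

Arbitrary marginals reduce to the cube by sampling: draw `2 ^ m` independent samples per coordinate,
and let `m` bits select one for each coordinate of a finite set `s`. The cube inequality holds for
every realisation. Two independent choices rarely collide on `s`, and without a collision they yield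
independent points. Integrating and letting `m → ∞` gives the bound for witnesses inside `s`; the
sets `s` then exhaust `ℕ`.

Measurability: `[A]_K` is the complement of a projection, so it is coanalytic rather than Borel in
general. Coanalytic sets are stable under the operations used and universally measurable, so
induction on `r` stays inside this class. -/

/-! ### Reimer's inequality on the discrete cube -/

/-- The columns in `C` are linearly independent and supported on the rows in `T`. -/
theorem ncard_le_ncard_of_det_ne_zero {α : Type*} [Fintype α] [DecidableEq α]
    (M : Matrix α α ℤ) (hM : M.det ≠ 0) (C T : Set α) (h : ∀ z ∉ T, ∀ x ∈ C, M z x = 0) :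
    C.ncard ≤ T.ncard := by
  classical
  let L : (C → ℤ) →ₗ[ℤ] (T → ℤ) :=
    Matrix.mulVecLin (M.submatrix (fun z : T => (z : α)) (fun x : C => (x : α)))
  have hL : Function.Injective L := by
    rw [← LinearMap.ker_eq_bot, LinearMap.ker_eq_bot']
    intro c hc
    let c' : α → ℤ := fun x => if hx : x ∈ C then c ⟨x, hx⟩ else 0
    have key : ∀ z, (M.mulVec c') z = ∑ x : C, M z x * c x := by
      intro z
      rw [Matrix.mulVec, dotProduct, ← Finset.sum_subset (Finset.subset_univ C.toFinset)]
      · refine (Finset.sum_subtype C.toFinset (p := (· ∈ C)) (by simp)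
          (fun x => M z x * c' x)).trans (Finset.sum_congr rfl fun x _ => ?_)
        simp [c']
      · intro x _ hx
        have : x ∉ C := by simpa using hx
        simp [c', this]
    have h0 : M.mulVec c' = 0 := by
      funext z
      rw [key]
      by_cases hz : z ∈ T
      · exact congrFun hc ⟨z, hz⟩
      · exact Finset.sum_eq_zero fun x _ => by rw [h z hz x x.2, zero_mul]
    have := Matrix.eq_zero_of_mulVec_eq_zero hM h0
    funext x
    have hx := congrFun this x
    simpa [c'] using hx
  have := card_le_of_injective ℤ L hL
  simpa [← Nat.card_eq_fintype_card, Set.ncard] using this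

/-- Modulo `p` the matrix is the identity, so its determinant is 1 there. -/
theorem det_prod_ne_zero {ι : Type*} [Fintype ι] [DecidableEq ι] (p : ℕ) [Fact p.Prime]
    (E : (ι → Bool) → ι → Bool → ℤ)
    (hE : ∀ x i b, (E x i b : ZMod p) = if x i = b then 1 else 0) :
    (Matrix.of fun x z : ι → Bool => ∏ i, E x i (z i)).det ≠ 0 := by
  intro h0
  have h1 : (Int.castRingHom (ZMod p)).mapMatrix
      (Matrix.of fun x z : ι → Bool => ∏ i, E x i (z i)) = 1 := by
    ext x z
    simp only [RingHom.mapMatrix_apply, Matrix.map_apply, Matrix.of_apply,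
      Int.coe_castRingHom, Int.cast_prod, hE, Matrix.one_apply]
    simp [Finset.prod_ite_zero, funext_iff]
  have h2 := RingHom.map_det (Int.castRingHom (ZMod p))
    (Matrix.of fun x z : ι → Bool => ∏ i, E x i (z i))
  rw [h1, h0] at h2
  simp at h2

/-- Two orthogonal vectors of `ℤ²` which reduce to the standard basis modulo `3`, and to the
swapped standard basis modulo `2`. -/
def tiltedVec : Bool → Bool → ℤ
  | false, false => 4
  | false, true => 3
  | true, false => -3
  | true, true => 4

/-- Butterfly form of Reimer's theorem, for the partial complementation `x ↦ x ⊕ d`. -/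
theorem ncard_bkr_le_ncard_xor {ι : Type*} [Fintype ι] (A B : Set (ι → Bool)) (d : ι → Bool) :
    (bkr A B).ncard ≤ {x | x ∈ A ∧ (fun i => xor (x i) (d i)) ∈ B}.ncard := by
  classical
  have hJ : ∀ x : ι → Bool, ∃ J : Finset ι, x ∈ bkr A B →
      thinCyl (J : Set ι) x ⊆ A ∧ thinCyl ((J : Set ι)ᶜ) x ⊆ B := by
    intro x
    by_cases hx : x ∈ bkr A B
    · simp only [bkr, Set.mem_iUnion] at hx
      obtain ⟨J, K, hd, h1, h2⟩ := hx
      refine ⟨J, fun _ => ⟨h1, fun y hy => h2 fun i hi => hy i ?_⟩⟩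
      exact fun hi' => Finset.disjoint_left.1 hd hi' hi
    · exact ⟨∅, fun h => absurd h hx⟩
  choose J hJ using hJ
  -- A tilted factor must reduce to the standard vector of the bit that indexes it: hence `!x i` for
  -- `V` (mod 2) and `z i` for `H` (mod 3). Where `d i` is true and both factors are tilted, they
  -- are orthogonal exactly when `z i = x i`; two standard factors are orthogonal exactly when `z i
  -- ≠ x i`.
  let V : (ι → Bool) → ι → Bool → ℤ := fun x i b =>
    if i ∈ J x ∨ d i = false then (if x i = b then 1 else 0) else tiltedVec (!x i) b
  let H : (ι → Bool) → ι → Bool → ℤ := fun z i b =>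
    if z ∉ A ∨ d i = false then (if z i = b then 1 else 0) else tiltedVec (z i) b
  have hV := @det_prod_ne_zero ι _ _ 2 _ V (by
    intro x i b
    simp only [V]
    split_ifs with h1 h2 h2
    · simp
    · simp
    · subst h2; cases x i <;> decide
    · cases hx : x i <;> cases b <;> simp_all <;> decide)
  have hH := @det_prod_ne_zero ι _ _ 3 _ H (by
    intro x i b
    simp only [H]
    split_ifs with h1 h2 h2
    · simp
    · simp
    · subst h2; cases x i <;> decide
    · cases hx : x i <;> cases b <;> simp_all <;> decide)
  refine ncard_le_ncard_of_det_ne_zero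
    (Matrix.of (fun x z : ι → Bool => ∏ i, H x i (z i)) *
      (Matrix.of (fun x z : ι → Bool => ∏ i, V x i (z i))).transpose) ?_ _ _ ?_
  · rw [Matrix.det_mul, Matrix.det_transpose]
    exact mul_ne_zero hH hV
  · intro z hz x hx
    have hfac : (Matrix.of (fun x z : ι → Bool => ∏ i, H x i (z i)) *
      (Matrix.of (fun x z : ι → Bool => ∏ i, V x i (z i))).transpose) z x =
        ∏ i, ∑ b, H z i b * V x i b := by
      rw [Fintype.prod_sum]
      simp [Matrix.mul_apply, Finset.prod_mul_distrib]
    rw [hfac, Finset.prod_eq_zero_iff]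
    obtain ⟨hA, hB⟩ := hJ x hx
    by_cases hzA : z ∈ A
    · have hzB : (fun i => xor (z i) (d i)) ∉ B := fun h => hz ⟨hzA, h⟩
      have : ∃ i, i ∉ J x ∧ xor (z i) (d i) ≠ x i := by
        by_contra! hcon
        exact hzB (hB fun i hi => hcon i hi)
      obtain ⟨i, hi, hne⟩ := this
      refine ⟨i, Finset.mem_univ i, ?_⟩
      cases hd : d i <;> cases hzi : z i <;> cases hxi : x i <;>
        simp_all [H, V, tiltedVec]
    · have : ∃ i ∈ J x, z i ≠ x i := by
        by_contra! hcon
        exact hzA (hA fun i hi => hcon i hi)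
      obtain ⟨i, hi, hne⟩ := this
      refine ⟨i, Finset.mem_univ i, ?_⟩
      cases hzi : z i <;> cases hxi : x i <;> simp_all [H, V]

/-- **Reimer's theorem** on the discrete cube, with the uniform measure. -/
theorem two_pow_mul_ncard_bkr_le {ι : Type*} [Fintype ι] (A B : Set (ι → Bool)) :
    2 ^ Fintype.card ι * (bkr A B).ncard ≤ A.ncard * B.ncard := by
  classical
  have h1 : ∑ d : ι → Bool, (bkr A B).ncard ≤
      ∑ d : ι → Bool, {x | x ∈ A ∧ (fun i => xor (x i) (d i)) ∈ B}.ncard :=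
    Finset.sum_le_sum fun d _ => ncard_bkr_le_ncard_xor A B d
  -- For fixed `x`, the point `x ⊕ d` runs once over the cube as `d` does.
  have h2 : ∑ d : ι → Bool, {x | x ∈ A ∧ (fun i => xor (x i) (d i)) ∈ B}.ncard =
      (A ×ˢ B).ncard := by
    simp only [← Nat.card_coe_set_eq]
    rw [← Nat.card_sigma]
    refine Nat.card_congr
      { toFun := fun p => ⟨(p.2.1, fun i => xor (p.2.1 i) (p.1 i)), p.2.2.1, p.2.2.2⟩
        invFun := fun q => ⟨fun i => xor (q.1.1 i) (q.1.2 i), q.1.1, q.2.1, by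
          simpa using q.2.2⟩
        left_inv := ?_
        right_inv := fun q => by simp }
    rintro ⟨d, x, hx⟩
    have : (fun i => xor (x i) (xor (x i) (d i))) = d := by simp
    exact Sigma.subtype_ext this rfl
  rw [h2, Set.ncard_prod] at h1
  simpa using h1

/-! ### Universal measurability of analytic sets -/

-- Outer measure is continuous along increasing unions of arbitrary sets, so the coordinates of the
-- parameter can be bounded one after another while the image keeps measure above `c`. The
-- parameters obeying all bounds form a compact set, whose image is the required `F`.
open Filter Topology in
theorem exists_measurableSet_subset_range_of_lt {α : Type*} [TopologicalSpace α] [T2Space α]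
    [MeasurableSpace α] [OpensMeasurableSpace α] (μ : Measure α) [IsFiniteMeasure μ]
    {g : (ℕ → ℕ) → α} (hg : Continuous g) {c : ENNReal} (hc : c < μ (Set.range g)) :
    ∃ F ⊆ Set.range g, MeasurableSet F ∧ c ≤ μ F := by
  have step : ∀ (n : ℕ) (D : Set (ℕ → ℕ)), ∃ k : ℕ, c < μ (g '' D) →
      c < μ (g '' (D ∩ {x | x n ≤ k})) := by
    intro n D
    by_cases h : c < μ (g '' D)
    · have hU : g '' D = ⋃ k : ℕ, g '' (D ∩ {x | x n ≤ k}) := by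
        rw [← Set.image_iUnion, ← Set.inter_iUnion]
        congr 1
        refine (Set.inter_eq_left.2 fun x _ => Set.mem_iUnion.2 ⟨x n, le_refl (x n)⟩).symm
      have hm : Monotone fun k : ℕ => g '' (D ∩ {x | x n ≤ k}) := fun a b hab =>
        Set.image_mono (Set.inter_subset_inter_right _ fun x (hx : x n ≤ a) => hx.trans hab)
      rw [hU, hm.measure_iUnion, lt_iSup_iff] at h
      obtain ⟨k, hk⟩ := h
      exact ⟨k, fun _ => hk⟩
    · exact ⟨0, fun h' => absurd h' h⟩
  choose k hk using step
  let D : ℕ → Set (ℕ → ℕ) := fun n =>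
    Nat.rec Set.univ (fun n D => D ∩ {x | x n ≤ k n D}) n
  let b : ℕ → ℕ := fun n => k n (D n)
  have hDc : ∀ n, c < μ (g '' D n) := by
    intro n
    induction n with
    | zero => simpa [D] using hc
    | succ n ih => exact hk n (D n) ih
  have hD : ∀ n x, x ∈ D n ↔ ∀ i < n, x i ≤ b i := by
    intro n
    induction n with
    | zero => simp [D]
    | succ n ih =>
      intro x
      change (x ∈ D n ∧ x n ≤ b n) ↔ _
      rw [ih, Nat.forall_lt_succ_right]
  have hanti : Antitone D := fun m n hmn x hx =>
    (hD m x).2 fun i hi => (hD n x).1 hx i (hi.trans_le hmn)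
  let K : Set (ℕ → ℕ) := Set.univ.pi fun i => Set.Iic (b i)
  have hK : IsCompact K := isCompact_univ_pi fun i => (Set.finite_Iic (b i)).isCompact
  have hsub : ⋂ n, closure (g '' D n) ⊆ g '' K := by
    intro y hy
    by_contra hyK
    obtain ⟨V, U, hV, hU, hKV, hyU, hUV⟩ :=
      SeparatedNhds.of_isCompact_isCompact (hK.image hg) (isCompact_singleton (x := y))
        (Set.disjoint_singleton_right.2 hyK)
    have hcyl : ∀ x : ℕ → ℕ, ∃ n, x ∈ K → PiNat.cylinder x n ⊆ g ⁻¹' V := by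
      intro x
      by_cases hx : x ∈ K
      · have hxV : g ⁻¹' V ∈ 𝓝 x := (hV.preimage hg).mem_nhds (hKV ⟨x, hx, rfl⟩)
        obtain ⟨_, ⟨x', n, rfl⟩, hxn, hn⟩ :=
          (PiNat.isTopologicalBasis_cylinders (E := fun _ => ℕ)).mem_nhds_iff.1 hxV
        rw [PiNat.mem_cylinder_iff_eq] at hxn
        exact ⟨n, fun _ => hxn ▸ hn⟩
      · exact ⟨0, fun h => absurd h hx⟩
    choose n hn using hcyl
    obtain ⟨t, htK, ht⟩ := hK.elim_nhds_subcover (fun x => PiNat.cylinder x (n x))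
      fun x _ => (PiNat.isOpen_cylinder _ x _).mem_nhds (PiNat.self_mem_cylinder _ _)
    have hDV : g '' D (t.sup n) ⊆ V := by
      rintro _ ⟨z, hz, rfl⟩
      rw [hD] at hz
      -- Truncation at `b` moves `z` into `K` without changing the coordinates that the covering
      -- cylinders see.
      have hz' : (fun i => min (z i) (b i)) ∈ K := fun i _ => min_le_right (z i) (b i)
      obtain ⟨x, hxt, hx⟩ := Set.mem_iUnion₂.1 (ht hz')
      refine hn x (htK x hxt) fun i hi => ?_
      rw [← hx i hi]
      exact (min_eq_left (hz i (hi.trans_le (Finset.le_sup hxt)))).symm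
    obtain ⟨w, hwU, hwV⟩ := mem_closure_iff.1 (Set.mem_iInter.1 hy (t.sup n)) U hU
      (hyU rfl)
    exact Set.disjoint_left.1 hUV (hDV hwV) hwU
  refine ⟨g '' K, Set.image_subset_range _ _, (hK.image hg).isClosed.measurableSet, ?_⟩
  have hlim := tendsto_measure_iInter_atTop (μ := μ) (s := fun n => closure (g '' D n))
    (fun n => isClosed_closure.measurableSet.nullMeasurableSet)
    (fun m n hmn => closure_mono (Set.image_mono (hanti hmn))) ⟨0, measure_ne_top _ _⟩
  exact (ge_of_tendsto' hlim fun n => (hDc n).le.trans (measure_mono subset_closure)).trans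
    (measure_mono hsub)

/-- Analytic sets are universally measurable. -/
theorem AnalyticSet.nullMeasurableSet {α : Type*} [TopologicalSpace α] [T2Space α]
    [MeasurableSpace α] [OpensMeasurableSpace α] (μ : Measure α) [IsFiniteMeasure μ]
    {A : Set α} (hA : AnalyticSet A) : NullMeasurableSet A μ := by
  rw [AnalyticSet_def] at hA
  obtain rfl | ⟨g, hg, rfl⟩ := hA
  · exact nullMeasurableSet_empty
  rcases eq_zero_or_pos (μ (Set.range g)) with h0 | hpos
  · exact NullMeasurableSet.of_null h0
  obtain ⟨u, -, hu, hlim⟩ := exists_seq_strictMono_tendsto' hpos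
  choose F hF hFm hFc using fun n => exists_measurableSet_subset_range_of_lt μ hg (hu n).2
  have hm : MeasurableSet (⋃ n, F n) := MeasurableSet.iUnion hFm
  refine hm.nullMeasurableSet.congr ?_
  refine ae_eq_of_subset_of_measure_ge (Set.iUnion_subset hF) ?_ hm.nullMeasurableSet
    (measure_ne_top _ _)
  exact le_of_tendsto' hlim fun n => (hFc n).trans (measure_mono (Set.subset_iUnion F n))

/-! ### Coanalytic sets and their stability -/

/-- The complement of `A` is analytic. -/
def IsCoanalytic {α : Type*} [TopologicalSpace α] (A : Set α) : Prop :=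
  AnalyticSet Aᶜ

theorem MeasurableSet.isCoanalytic {α : Type*} [TopologicalSpace α] [PolishSpace α]
    [MeasurableSpace α] [BorelSpace α] {A : Set α} (hA : MeasurableSet A) : IsCoanalytic A :=
  hA.compl.analyticSet

namespace IsCoanalytic

variable {α : Type*} [TopologicalSpace α]

theorem nullMeasurableSet [T2Space α] [MeasurableSpace α] [OpensMeasurableSpace α]
    (μ : Measure α) [IsFiniteMeasure μ] {A : Set α} (hA : IsCoanalytic A) :
    NullMeasurableSet A μ :=
  (AnalyticSet.nullMeasurableSet μ hA).of_compl

theorem iInter {ι : Type*} [Countable ι] {A : ι → Set α} (hA : ∀ i, IsCoanalytic (A i)) :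
    IsCoanalytic (⋂ i, A i) := by
  rw [IsCoanalytic, Set.compl_iInter]
  exact AnalyticSet.iUnion hA

theorem iUnion [PolishSpace α] {ι : Type*} [Countable ι] {A : ι → Set α}
    (hA : ∀ i, IsCoanalytic (A i)) : IsCoanalytic (⋃ i, A i) := by
  borelize α
  cases isEmpty_or_nonempty ι
  · rw [Set.iUnion_of_empty]
    exact MeasurableSet.empty.isCoanalytic
  · rw [IsCoanalytic, Set.compl_iUnion]
    exact AnalyticSet.iInter hA

theorem iUnion_prop [PolishSpace α] {p : Prop} {A : p → Set α}
    (hA : ∀ h, IsCoanalytic (A h)) : IsCoanalytic (⋃ h, A h) := by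
  borelize α
  by_cases hp : p
  · simpa [hp] using hA hp
  · simpa [hp] using MeasurableSet.empty.isCoanalytic

theorem inter {A B : Set α} (hA : IsCoanalytic A) (hB : IsCoanalytic B) :
    IsCoanalytic (A ∩ B) := by
  rw [Set.inter_eq_iInter]
  exact iInter fun b => by cases b <;> assumption

/-- A point lies outside `[A]_K` iff some point of `Aᶜ` agrees with it on `K`; this exhibits the
complement as the projection of an analytic set. -/
theorem maxCyl {I S : Type*} [Countable I] [TopologicalSpace S] [PolishSpace S]
    {A : Set (I → S)} (hA : IsCoanalytic A) (K : Set I) : IsCoanalytic (maxCyl A K) := by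
  have h : (_root_.maxCyl A K)ᶜ = Prod.fst ''
      (⋂ b : Bool, bif b then {p : (I → S) × (I → S) | ∀ i ∈ K, p.2 i = p.1 i}
        else Prod.snd ⁻¹' Aᶜ) := by
    ext ω
    simp [_root_.maxCyl, thinCyl, Set.not_subset, and_comm]
  rw [IsCoanalytic, h]
  refine AnalyticSet.image_of_continuous (AnalyticSet.iInter fun b => ?_) continuous_fst
  cases b
  · exact AnalyticSet.preimage hA continuous_snd
  · have : IsClosed {p : (I → S) × (I → S) | ∀ i ∈ K, p.2 i = p.1 i} := by
      simp only [Set.ofPred_forall]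
      exact isClosed_biInter fun i _ => isClosed_eq (by fun_prop) (by fun_prop)
    exact this.analyticSet

theorem bkr {I S : Type*} [Countable I] [TopologicalSpace S] [PolishSpace S]
    {A B : Set (I → S)} (hA : IsCoanalytic A) (hB : IsCoanalytic B) :
    IsCoanalytic (bkr A B) :=
  iUnion fun J => iUnion fun K => iUnion_prop fun _ => (hA.maxCyl J).inter (hB.maxCyl K)

theorem bkrMany {I S : Type*} [Countable I] [TopologicalSpace S] [PolishSpace S] {r : ℕ}
    {A : Fin r → Set (I → S)} (hA : ∀ i, IsCoanalytic (A i)) : IsCoanalytic (bkrMany A) :=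
  iUnion fun J => iUnion_prop fun _ => iInter fun i => (hA i).maxCyl (J i)

end IsCoanalytic

/-! ### Bounded witnesses and the recursion in the number of events -/

/-- The part of `bkr A B` which has witnesses inside the finite set `s`. -/
def bkrIn {I S : Type*} (s : Finset I) (A B : Set (I → S)) : Set (I → S) :=
  ⋃ (J : Finset I) (K : Finset I) (_ : Disjoint J K ∧ J ⊆ s ∧ K ⊆ s),
    maxCyl A (J : Set I) ∩ maxCyl B (K : Set I)

theorem mem_bkrIn {I S : Type*} {s : Finset I} {A B : Set (I → S)} {ω : I → S} :
    ω ∈ bkrIn s A B ↔ ∃ J K : Finset I, (Disjoint J K ∧ J ⊆ s ∧ K ⊆ s) ∧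
      ω ∈ maxCyl A (J : Set I) ∧ ω ∈ maxCyl B (K : Set I) := by
  simp only [bkrIn, Set.mem_iUnion, exists_prop, Set.mem_inter_iff]

theorem bkrIn_mono {I S : Type*} {s t : Finset I} (h : s ⊆ t) (A B : Set (I → S)) :
    bkrIn s A B ⊆ bkrIn t A B := by
  intro ω hω
  rw [mem_bkrIn] at hω ⊢
  obtain ⟨J, K, ⟨hd, hJ, hK⟩, hω⟩ := hω
  exact ⟨J, K, ⟨hd, hJ.trans h, hK.trans h⟩, hω⟩

theorem bkr_eq_iUnion_bkrIn {I S : Type*} (A B : Set (I → S)) :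
    bkr A B = ⋃ s : Finset I, bkrIn s A B := by
  classical
  ext ω
  simp only [bkr, Set.mem_iUnion, mem_bkrIn]
  constructor
  · rintro ⟨J, K, hd, hω⟩
    exact ⟨J ∪ K, J, K, ⟨hd, Finset.subset_union_left, Finset.subset_union_right⟩, hω⟩
  · rintro ⟨s, J, K, ⟨hd, -, -⟩, hω⟩
    exact ⟨J, K, hd, hω⟩

theorem IsCoanalytic.bkrIn {I S : Type*} [Countable I] [TopologicalSpace S] [PolishSpace S]
    {A B : Set (I → S)} (hA : IsCoanalytic A) (hB : IsCoanalytic B) (s : Finset I) :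
    IsCoanalytic (bkrIn s A B) :=
  iUnion fun J => iUnion fun K => iUnion_prop fun _ => (hA.maxCyl J).inter (hB.maxCyl K)

/-- The union of the last `r` witnesses is a witness for their joint occurrence, and it is disjoint
from `J 0`. -/
theorem bkrMany_succ_subset {I S : Type*} {r : ℕ} (A : Fin (r + 1) → Set (I → S)) :
    bkrMany A ⊆ bkr (A 0) (bkrMany fun i => A i.succ) := by
  classical
  intro ω hω
  simp only [bkrMany, Set.mem_iUnion, Set.mem_iInter] at hω
  obtain ⟨J, hd, hω⟩ := hω
  simp only [bkr, Set.mem_iUnion]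
  refine ⟨J 0, Finset.univ.biUnion fun i : Fin r => J i.succ, ?_, hω 0, fun ω' hω' => ?_⟩
  · exact (Finset.disjoint_biUnion_right _ _ _).2 fun i _ => hd _ _ (Fin.succ_ne_zero i).symm
  · simp only [bkrMany, Set.mem_iUnion, Set.mem_iInter]
    refine ⟨fun i => J i.succ, fun i j hij => hd _ _ fun h => hij (Fin.succ_injective _ h),
      fun i y hy => hω i.succ fun a ha => ?_⟩
    rw [hy a ha]
    exact hω' a (by simpa using ⟨i, ha⟩)

/-! ### Independent samples for each coordinate -/

section Sampling

variable {I S κ : Type*} [MeasurableSpace S]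

/-- The point of `S^I` whose `i`-th coordinate is the sample number `f i` for that coordinate. -/
def selectSample (f : I → κ) (X : I × κ → S) : I → S := fun i => X (i, f i)

variable (μ : I → Measure S) [∀ i, IsProbabilityMeasure (μ i)]

theorem measurePreserving_selectSample (f : I → κ) :
    MeasurePreserving (selectSample f) (Measure.infinitePi fun p : I × κ => μ p.1)
      (Measure.infinitePi μ) where
  measurable := by unfold selectSample; fun_prop
  map_eq := Measure.map_infinitePi_infinitePi_of_inj (P := fun p : I × κ => μ p.1)
    (f := fun i => (i, f i)) fun _ _ h => congrArg Prod.fst h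

/-- As `f` and `g` never select the same sample, the two selected points depend on disjoint families
of independent variables. -/
theorem measure_selectSample_inter {f g : I → κ} (hfg : ∀ i, f i ≠ g i) {A B : Set (I → S)}
    (hA : MeasurableSet A) (hB : MeasurableSet B) :
    (Measure.infinitePi fun p : I × κ => μ p.1) (selectSample f ⁻¹' A ∩ selectSample g ⁻¹' B) =
      Measure.infinitePi μ A * Measure.infinitePi μ B := by
  let φ : Bool × I → I × κ := fun p => (p.2, bif p.1 then f p.2 else g p.2)
  have hφ : Function.Injective φ := by
    rintro ⟨a, i⟩ ⟨b, j⟩ h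
    obtain ⟨rfl, h2⟩ := Prod.mk.inj h
    have := hfg i
    have := (hfg i).symm
    cases a <;> cases b <;> simp_all
  have h1 := Measure.map_infinitePi_infinitePi_of_inj (P := fun p : I × κ => μ p.1) hφ
  have h2 := Measure.infinitePi_map_curry (ι := Bool) (κ := I) (fun _ i => μ i)
  let t : Bool → Set (I → S) := fun b => bif b then A else B
  have ht : ∀ b, MeasurableSet (t b) := fun b => by cases b <;> assumption
  have h3 := Measure.infinitePi_pi (fun _ : Bool => Measure.infinitePi μ) (s := Finset.univ)
    (t := t) fun b _ => ht b
  have hm : MeasurableSet (((Finset.univ : Finset Bool) : Set Bool).pi t) :=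
    MeasurableSet.pi (Set.to_countable _) fun b _ => ht b
  rw [← h2, Measure.map_apply (by fun_prop) hm] at h3
  have h1' : (Measure.infinitePi fun p : Bool × I => μ p.2) =
    Measure.map (fun ω p => ω (φ p)) (Measure.infinitePi fun p : I × κ => μ p.1) := h1.symm
  rw [h1', Measure.map_apply (by fun_prop) (hm.preimage (by fun_prop))] at h3
  rw [Fintype.prod_bool] at h3
  refine Eq.trans ?_ h3
  congr 1
  ext X
  simp [φ, t]
  rfl

end Sampling

/-- Two uniform choices agree on row `i` with probability at most `1 / |κ → β|`: overwriting row `i`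
of the first by an arbitrary row is injective, since the lost row can be read off from the second.
-/
theorem card_row_eq_mul_le {s κ β : Type*} [Fintype s] [Fintype κ] [Fintype β] [DecidableEq s]
    [DecidableEq κ] [DecidableEq β] (i : s) :
    (Finset.univ.filter fun p : (s × κ → β) × (s × κ → β) =>
      ∀ j, p.1 (i, j) = p.2 (i, j)).card * Fintype.card (κ → β) ≤
      Fintype.card (s × κ → β) * Fintype.card (s × κ → β) := by
  rw [← Finset.card_univ (α := κ → β), ← Finset.card_product, ← Fintype.card_prod,
    ← Finset.card_univ (α := (s × κ → β) × (s × κ → β))]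
  refine Finset.card_le_card_of_injOn
    (fun q => (fun a => if a.1 = i then q.2 a.2 else q.1.1 a, q.1.2))
    (fun _ _ => Finset.mem_coe.2 (Finset.mem_univ _)) ?_
  rintro ⟨⟨x, y⟩, z⟩ h ⟨⟨x', y'⟩, z'⟩ h' heq
  simp only [Finset.coe_product, Finset.coe_filter, Finset.mem_univ, true_and, Set.mem_prod,
    Set.mem_ofPred_eq, Finset.coe_univ, Set.mem_univ, and_true] at h h'
  obtain ⟨h1, rfl⟩ := Prod.mk.inj heq
  have hz : z = z' := funext fun j => by simpa using congrFun h1 (i, j)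
  have hx : x = x' := by
    funext a
    by_cases ha : a.1 = i
    · obtain ⟨a, j⟩ := a
      obtain rfl : a = i := ha
      rw [h, h']
    · simpa [ha] using congrFun h1 a
  rw [hz, hx]

theorem lintegral_ncard {Ω ι : Type*} [MeasurableSpace Ω] (P : Measure Ω) [Fintype ι]
    {E : ι → Set Ω} (hE : ∀ x, NullMeasurableSet (E x) P) :
    ∫⁻ ω, ({x | ω ∈ E x}.ncard : ENNReal) ∂P = ∑ x, P (E x) := by
  classical
  have h : ∀ ω, ({x | ω ∈ E x}.ncard : ENNReal) = ∑ x, (E x).indicator 1 ω := by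
    intro ω
    rw [Set.ncard_eq_toFinset_card']
    simp [Set.indicator_apply, Finset.sum_boole]
  simp_rw [h]
  refine (lintegral_finsetSum' _ fun x _ =>
    AEMeasurable.indicator₀ aemeasurable_one (hE x)).trans ?_
  exact Finset.sum_congr rfl fun x _ => lintegral_indicator_one₀ (hE x)

section Sampling

variable {I S : Type*}

open Classical in
/-- The extension by `a` of a choice of samples for the coordinates in `s`. -/
noncomputable def extendChoice {s : Finset I} {m : ℕ} (a : Bool) (x : s × Fin m → Bool) :
    I → (Fin m → Bool) :=
  fun i => if h : i ∈ s then fun j => x (⟨i, h⟩, j) else fun _ => a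

/-- A witness in `s` lifts to all the selecting bits of its coordinates. The default outside `s` may
differ between `A` and `B`, because the witnesses never look there. -/
theorem two_pow_mul_ncard_bkrIn_le (s : Finset I) (m : ℕ) (A B : Set (I → S))
    (X : I × (Fin m → Bool) → S) :
    2 ^ Fintype.card (s × Fin m) *
      {x : s × Fin m → Bool | selectSample (extendChoice false x) X ∈ bkrIn s A B}.ncard ≤
    {x : s × Fin m → Bool | selectSample (extendChoice false x) X ∈ A}.ncard *
    {x : s × Fin m → Bool | selectSample (extendChoice true x) X ∈ B}.ncard := by
  classical
  refine (Nat.mul_le_mul_left _ (Set.ncard_le_ncard ?_ (Set.toFinite _))).trans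
    (two_pow_mul_ncard_bkr_le _ _)
  intro x hx
  obtain ⟨J, K, ⟨hd, hJ, hK⟩, hA, hB⟩ := mem_bkrIn.1 hx
  simp only [bkr, Set.mem_iUnion]
  refine ⟨Finset.univ.filter fun p => (p.1 : I) ∈ J, Finset.univ.filter fun p => (p.1 : I) ∈ K,
    ?_, ?_, ?_⟩
  · rw [Finset.disjoint_left] at hd ⊢
    intro p hp hp'
    exact hd (Finset.mem_filter.1 hp).2 (Finset.mem_filter.1 hp').2
  · intro y hy
    refine hA fun i hi => ?_
    have : ∀ j, y (⟨i, hJ hi⟩, j) = x (⟨i, hJ hi⟩, j) := fun j => hy _ (by simpa using hi)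
    simp [selectSample, extendChoice, hJ hi, this]
  · intro y hy
    refine hB fun i hi => ?_
    have : ∀ j, y (⟨i, hK hi⟩, j) = x (⟨i, hK hi⟩, j) := fun j => hy _ (by simpa using hi)
    simp [selectSample, extendChoice, hK hi, this]

variable [MeasurableSpace S] (μ : I → Measure S) [∀ i, IsProbabilityMeasure (μ i)]

/-- The error term is a union bound for a collision of two uniform choices on some coordinate of
`s`. -/
theorem measure_bkrIn_le_add (s : Finset I) {m : ℕ} (hm : 0 < m) {A B : Set (I → S)}
    (hC : NullMeasurableSet (bkrIn s A B) (Measure.infinitePi μ)) :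
    Measure.infinitePi μ (bkrIn s A B) ≤
      Measure.infinitePi μ A * Measure.infinitePi μ B + s.card * ((2 : ENNReal) ^ m)⁻¹ := by
  classical
  let Q := Measure.infinitePi fun p : I × (Fin m → Bool) => μ p.1
  let P := Measure.infinitePi μ
  let D := s × Fin m → Bool
  -- Measurable hulls have the same measure, so no measurability of `A` and `B` is needed.
  let tA := toMeasurable P A
  let tB := toMeasurable P B
  let E : D × D → Set (I × (Fin m → Bool) → S) := fun p =>
    selectSample (extendChoice false p.1) ⁻¹' tA ∩ selectSample (extendChoice true p.2) ⁻¹' tB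
  let R : s → Finset (D × D) := fun i =>
    Finset.univ.filter fun p => ∀ j, p.1 (i, j) = p.2 (i, j)
  have hmp := fun f : I → (Fin m → Bool) => measurePreserving_selectSample μ f
  have hpoint : ∀ X, (2 : ENNReal) ^ Fintype.card (s × Fin m) *
      ({x : D | X ∈ selectSample (extendChoice false x) ⁻¹' bkrIn s A B}.ncard : ENNReal) ≤
      ({p | X ∈ E p}.ncard : ENNReal) := by
    intro X
    have h1 := two_pow_mul_ncard_bkrIn_le s m A B X
    rw [← Set.ncard_prod] at h1
    have h2 := h1.trans (Set.ncard_le_ncard (t := {p | X ∈ E p}) (fun p hp =>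
      ⟨subset_toMeasurable P A hp.1, subset_toMeasurable P B hp.2⟩) (Set.toFinite _))
    exact_mod_cast h2
  have hint := lintegral_mono (μ := Q) hpoint
  rw [lintegral_const_mul' _ _ (by simp), lintegral_ncard Q fun x =>
      hC.preimage (hmp (extendChoice false x)).quasiMeasurePreserving,
    lintegral_ncard Q fun p =>
      (((measurableSet_toMeasurable P A).preimage (hmp _).measurable).inter
      ((measurableSet_toMeasurable P B).preimage (hmp _).measurable)).nullMeasurableSet] at hint
  simp only [Q, (hmp _).measure_preimage hC, Finset.sum_const, Finset.card_univ, nsmul_eq_mul]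
    at hint
  have hE : ∀ p, Q (E p) ≤ P A * P B + ∑ i, if p ∈ R i then 1 else 0 := by
    intro p
    by_cases hp : ∃ i, p ∈ R i
    · obtain ⟨i, hi⟩ := hp
      refine prob_le_one.trans (le_add_left ?_)
      refine le_trans (by simp [hi]) (Finset.single_le_sum (f := fun i =>
        if p ∈ R i then (1 : ENNReal) else 0) (fun _ _ => zero_le) (Finset.mem_univ i))
    · have hne : ∀ i : I, extendChoice false p.1 i ≠ extendChoice true p.2 i := by
        intro i h
        by_cases hi : i ∈ s
        · refine hp ⟨⟨i, hi⟩, Finset.mem_filter.2 ⟨Finset.mem_univ _, fun j => ?_⟩⟩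
          simpa [extendChoice, hi] using congrFun h j
        -- Outside `s` the constant defaults `false` and `true` differ because `Fin m` is nonempty.
        · simpa [extendChoice, hi] using congrFun h ⟨0, hm⟩
      refine le_add_right (le_of_eq ?_)
      refine (measure_selectSample_inter μ hne (measurableSet_toMeasurable _ _)
        (measurableSet_toMeasurable _ _)).trans ?_
      rw [measure_toMeasurable, measure_toMeasurable]
  have hR : ∀ i, ((R i).card : ENNReal) ≤
      (Fintype.card D * Fintype.card D : ENNReal) * ((2 : ENNReal) ^ m)⁻¹ := by
    intro i
    rw [← div_eq_mul_inv, ENNReal.le_div_iff_mul_le (by simp) (by simp)]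
    have h : (R i).card * Fintype.card (Fin m → Bool) ≤ Fintype.card D * Fintype.card D := by
      convert card_row_eq_mul_le (κ := Fin m) (β := Bool) i
    rw [Fintype.card_fun, Fintype.card_bool, Fintype.card_fin] at h
    exact_mod_cast h
  have hsum : ∑ p, Q (E p) ≤ (Fintype.card D * Fintype.card D : ENNReal) *
      (P A * P B + s.card * ((2 : ENNReal) ^ m)⁻¹) := by
    refine (Finset.sum_le_sum fun p _ => hE p).trans ?_
    rw [Finset.sum_add_distrib, Finset.sum_comm, mul_add]
    refine add_le_add ?_ ?_
    · simp [Fintype.card_prod]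
    · calc _ = ∑ i, ((R i).card : ENNReal) := by simp
        _ ≤ ∑ i : s, (Fintype.card D * Fintype.card D : ENNReal) * ((2 : ENNReal) ^ m)⁻¹ :=
          Finset.sum_le_sum fun i _ => hR i
        _ = _ := by
          simp only [Finset.sum_const, Finset.card_univ, Fintype.card_coe, nsmul_eq_mul]
          ring
  have hfin := hint.trans hsum
  have hD : (2 : ENNReal) ^ Fintype.card (s × Fin m) = Fintype.card D := by
    simp [D]
  rw [hD, ← mul_assoc] at hfin
  have hD0 : (Fintype.card D : ENNReal) ≠ 0 := by simp [D]
  exact (ENNReal.mul_le_mul_iff_right (mul_ne_zero hD0 hD0)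
    (ENNReal.mul_ne_top (by simp) (by simp))).1 hfin

theorem measure_bkrIn_le (s : Finset I) {A B : Set (I → S)}
    (hC : NullMeasurableSet (bkrIn s A B) (Measure.infinitePi μ)) :
    Measure.infinitePi μ (bkrIn s A B) ≤ Measure.infinitePi μ A * Measure.infinitePi μ B := by
  have hlim : Filter.Tendsto (fun m : ℕ => Measure.infinitePi μ A * Measure.infinitePi μ B +
      s.card * ((2 : ENNReal) ^ m)⁻¹) Filter.atTop
      (nhds (Measure.infinitePi μ A * Measure.infinitePi μ B + s.card * 0)) := by
    refine tendsto_const_nhds.add (ENNReal.Tendsto.const_mul ?_ (Or.inr (by simp)))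
    simp_rw [ENNReal.inv_pow]
    exact ENNReal.tendsto_pow_atTop_nhds_zero_of_lt_one (by simp)
  rw [mul_zero, add_zero] at hlim
  exact ge_of_tendsto hlim ((Filter.eventually_gt_atTop 0).mono fun m hm =>
    measure_bkrIn_le_add μ s hm hC)

/-! ### The inequality for coanalytic events and the main theorem -/

variable [Countable I] [TopologicalSpace S] [PolishSpace S] [BorelSpace S]

/-- The **van den Berg–Kesten–Reimer inequality** for coanalytic events. -/
theorem IsCoanalytic.measure_bkr_le {A B : Set (I → S)} (hA : IsCoanalytic A)
    (hB : IsCoanalytic B) :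
    Measure.infinitePi μ (_root_.bkr A B) ≤
      Measure.infinitePi μ A * Measure.infinitePi μ B := by
  have hmono : Monotone fun s => _root_.bkrIn s A B := fun _ _ h => bkrIn_mono h A B
  rw [bkr_eq_iUnion_bkrIn, hmono.directed_le.measure_iUnion]
  exact iSup_le fun s => measure_bkrIn_le μ s ((hA.bkrIn hB s).nullMeasurableSet _)

theorem IsCoanalytic.measure_bkrMany_le {r : ℕ} {A : Fin r → Set (I → S)}
    (hA : ∀ i, IsCoanalytic (A i)) :
    Measure.infinitePi μ (_root_.bkrMany A) ≤ ∏ i, Measure.infinitePi μ (A i) := by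
  induction r with
  | zero => simpa using prob_le_one
  | succ r ih =>
    rw [Fin.prod_univ_succ]
    refine (measure_mono (bkrMany_succ_subset A)).trans ?_
    refine ((hA 0).measure_bkr_le μ (IsCoanalytic.bkrMany fun i => hA i.succ)).trans ?_
    gcongr
    exact ih fun i => hA i.succ

end Sampling

theorem mainTheorem5 (μ : ℕ → Measure ℝ) [∀ i, IsProbabilityMeasure (μ i)] :
    (∀ A B : Set (ℕ → ℝ), MeasurableSet A → MeasurableSet B →
      NullMeasurableSet (bkr A B) (Measure.infinitePi μ) ∧
        completeProd μ (bkr A B) ≤ completeProd μ A * completeProd μ B) ∧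
    (∀ (r : ℕ) (A : Fin r → Set (ℕ → ℝ)), (∀ i, MeasurableSet (A i)) →
      NullMeasurableSet (bkrMany A) (Measure.infinitePi μ) ∧
        completeProd μ (bkrMany A) ≤ ∏ i, completeProd μ (A i)) := by
  refine ⟨fun A B hA hB => ?_, fun r A hA => ?_⟩
  · exact ⟨(hA.isCoanalytic.bkr hB.isCoanalytic).nullMeasurableSet _,
      hA.isCoanalytic.measure_bkr_le μ hB.isCoanalytic⟩
  · exact ⟨(IsCoanalytic.bkrMany fun i => (hA i).isCoanalytic).nullMeasurableSet _,
      IsCoanalytic.measure_bkrMany_le μ fun i => (hA i).isCoanalytic⟩
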